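/- Let $N\ge 1$, let $\Omega\subset\mathbb{R}^N$ be a bounded open set with Lipschitz boundary, let $f:\Omega\to\mathbb{R}$ be measurable with $0\le f\le 1$ almost everywhere in $\Omega$, and let $\lambda\ge 0$. For $g\in L^1(\Omega)$ let $$|Dg|(\Omega)=\sup\Big\{\int_\Omega g\,\operatorname{div}\varphi\,dx:\ \varphi\in C^1_c(\Omega;\mathbb{R}^N),\ |\varphi|\le 1\Big\}\in[0,\infty]$$ be its total variation (it is infinite if $g\notin BV(\Omega)$), and let $BV(\Omega)=\{g\in L^1(\Omega): |Dg|(\Omega)<\infty\}$. For $\varepsilon>0$ define $F_\varepsilon:L^2(\Omega)^3\to[0,+\infty]$ by $$F_\varepsilon(u,v_1,v_2)=|Du|(\Omega)+\frac1\varepsilon\big(|Dv_1|(\Omega)+|Dv_2|(\Omega)\big)+\lambda\int_\Omega \big(u(v_1-f)^2+(1-u)(v_2-f)^2\big)\,dx+\int_\Omega \mathbb{I}_{[0,1]}(u)\,dx,$$ where $\mathbb{I}_{[0,1]}(t)=0$ if $t\in[0,1]$ and $\mathbb{I}_{[0,1]}(t)=+\infty$ otherwise; in particular $F_\varepsilon(u,v_1,v_2)=+\infty$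 unless $0\le u\le 1$ almost everywhere in $\Omega$. Then, for every $\varepsilon>0$, the functional $F_\varepsilon$ has a minimizer over $L^2(\Omega)^3$ which belongs to $BV(\Omega)^3$: there are $u,v_1,v_2\in L^2(\Omega)\cap BV(\Omega)$ with $F_\varepsilon(u,v_1,v_2)\le F_\varepsilon(u',v_1',v_2')$ for all $u',v_1',v_2'\in L^2(\Omega)$. -/

import Mathlib

open MeasureTheory Set
open scoped ENNReal NNReal

namespace ChanVese

/-- A subset `Ω` of `ℝ^N` has Lipschitz boundary if near each of its boundary points, for a
suitable choice of a vertical unit direction `e`, it is the open region lying strictly above the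
graph of a Lipschitz function defined on the hyperplane orthogonal to `e`. -/
def HasLipschitzBoundary {N : ℕ} (Ω : Set (EuclideanSpace ℝ (Fin N))) : Prop :=
  ∀ x ∈ frontier Ω, ∃ r : ℝ, 0 < r ∧ ∃ e : EuclideanSpace ℝ (Fin N), ‖e‖ = 1 ∧
    ∃ (K : ℝ≥0) (γ : (Submodule.span ℝ {e})ᗮ → ℝ), LipschitzWith K γ ∧
      ∀ y ∈ Metric.ball x r,
        (y ∈ Ω ↔ γ ((Submodule.span ℝ {e})ᗮ.orthogonalProjectionOnto y) < inner ℝ e y)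

/-- The divergence `∑ i, ∂φ_i/∂x_i` of a vector field on `ℝ^N`. -/
noncomputable def divergence {N : ℕ}
    (φ : EuclideanSpace ℝ (Fin N) → EuclideanSpace ℝ (Fin N))
    (x : EuclideanSpace ℝ (Fin N)) : ℝ :=
  ∑ i : Fin N, (fderiv ℝ φ x (EuclideanSpace.single i 1)) i

/-- The admissible test fields on `Ω`: continuously differentiable vector fields with compact
support contained in `Ω` and with Euclidean norm at most one at every point. -/
def testFields {N : ℕ} (Ω : Set (EuclideanSpace ℝ (Fin N))) :
    Set (EuclideanSpace ℝ (Fin N) → EuclideanSpace ℝ (Fin N)) :=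
  {φ | ContDiff ℝ 1 φ ∧ HasCompactSupport φ ∧ tsupport φ ⊆ Ω ∧ ∀ x, ‖φ x‖ ≤ 1}

/-- The total variation `|Du|(Ω) = sup {∫_Ω u div φ}` of an integrable function `u`, with the
supremum over all test fields `φ`; it is `∞` unless the distributional gradient of `u` is a
finite vector measure. The zero field is a test field, so cutting off negative values with
`ENNReal.ofReal` does not change the supremum. -/
noncomputable def totalVariation {N : ℕ} (Ω : Set (EuclideanSpace ℝ (Fin N)))
    (u : EuclideanSpace ℝ (Fin N) → ℝ) : ℝ≥0∞ :=
  ⨆ φ ∈ testFields Ω, ENNReal.ofReal (∫ x in Ω, u x * divergence φ x)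

/-- The space `BV(Ω)`: integrable functions on `Ω` of finite total variation. -/
def MemBV {N : ℕ} (Ω : Set (EuclideanSpace ℝ (Fin N)))
    (u : EuclideanSpace ℝ (Fin N) → ℝ) : Prop :=
  IntegrableOn u Ω ∧ totalVariation Ω u < ∞

open Classical in
/-- The indicator function, in the sense of convex analysis, of the interval `[0,1]`. -/
noncomputable def unitIndicator (t : ℝ) : ℝ≥0∞ :=
  if t ∈ Icc (0 : ℝ) 1 then 0 else ∞

/-- The functional `F_ε` on `L²(Ω)³`, with values in `[0, ∞]`. Unless `u` has values in `[0,1]`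
almost everywhere in `Ω` the last term is infinite; if it has, then the integrand of the fourth
term is nonnegative, so that its integral is the Lebesgue integral of a nonnegative function. -/
noncomputable def energy {N : ℕ} (Ω : Set (EuclideanSpace ℝ (Fin N)))
    (f : EuclideanSpace ℝ (Fin N) → ℝ) (lam ε : ℝ)
    (u v₁ v₂ : Lp ℝ 2 (volume.restrict Ω)) : ℝ≥0∞ :=
  totalVariation Ω u
    + ENNReal.ofReal (1 / ε) * (totalVariation Ω v₁ + totalVariation Ω v₂)
    + ENNReal.ofReal lam *
        ∫⁻ x in Ω, ENNReal.ofReal (u x * (v₁ x - f x) ^ 2 + (1 - u x) * (v₂ x - f x) ^ 2)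
    + ∫⁻ x in Ω, unitIndicator (u x)

end ChanVese

/-! The proof is the direct method. Truncating `v₁`, `v₂` to `[0, 1]` brings them closer to `f` and
does not increase their variation (`VarLe.clip`), so a minimizing sequence may be taken with values
in `[0, 1]` and uniformly bounded variations.

Such sequences are compact (`exists_subseq_tendsto_ae`). A subsequence converges weakly in `L²`.
Mollifying at scale `r` costs at most `r * C` in `L¹` on compact parts of `Ω`, while at fixed `r`
the mollifications converge pointwise; hence convergence is strong in `L¹` locally. The bound by 1
makes the remaining thin layer negligible, and a further subsequence converges almost everywhere.
Along it the variations are lower semicontinuous as suprema of continuous functionals, and the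
fidelity term by Fatou.

In `energy` the fidelity integral extends over everything to its right, so the constraint term sits
inside it and is multiplied by `lam`. The argument is therefore run for `constrainedEnergy`, and the
two functionals are compared at the end, with `lam = 0` apart. -/

namespace ChanVese

/-! ### Divergence and mollification. -/

section Calculus

open Filter Topology ContinuousLinearMap
open scoped Convolution

variable {N : ℕ}

theorem continuous_divergence {ψ : EuclideanSpace ℝ (Fin N) → EuclideanSpace ℝ (Fin N)}
    (hψ : ContDiff ℝ 1 ψ) :
    Continuous (divergence ψ) := by
  have h : Continuous (fderiv ℝ ψ) := hψ.continuous_fderiv one_ne_zero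
  unfold divergence
  fun_prop

theorem divergence_eq_zero_of_notMem_tsupport
    {ψ : EuclideanSpace ℝ (Fin N) → EuclideanSpace ℝ (Fin N)} {x : EuclideanSpace ℝ (Fin N)}
    (hx : x ∉ tsupport ψ) :
    divergence ψ x = 0 := by
  have : fderiv ℝ ψ x = 0 := by
    by_contra h
    exact hx (support_fderiv_subset ℝ h)
  simp [divergence, this]

theorem hasCompactSupport_divergence {ψ : EuclideanSpace ℝ (Fin N) → EuclideanSpace ℝ (Fin N)}
    (hψ : HasCompactSupport ψ) :
    HasCompactSupport (divergence ψ) :=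
  HasCompactSupport.intro hψ fun _ => divergence_eq_zero_of_notMem_tsupport

theorem exists_abs_divergence_le {ψ : EuclideanSpace ℝ (Fin N) → EuclideanSpace ℝ (Fin N)}
    (hψ : ContDiff ℝ 1 ψ) (hc : HasCompactSupport ψ) :
    ∃ M, ∀ x, |divergence ψ x| ≤ M :=
  (continuous_divergence hψ).bounded_above_of_compact_support (hasCompactSupport_divergence hc)

theorem divergence_smul {a : EuclideanSpace ℝ (Fin N) → ℝ}
    {φ : EuclideanSpace ℝ (Fin N) → EuclideanSpace ℝ (Fin N)} {x : EuclideanSpace ℝ (Fin N)}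
    (ha : DifferentiableAt ℝ a x)
    (hφ : DifferentiableAt ℝ φ x) :
    divergence (fun y => a y • φ y) x = a x * divergence φ x + fderiv ℝ a x (φ x) := by
  have h1 : fderiv ℝ a x (φ x)
      = ∑ i, fderiv ℝ a x (EuclideanSpace.single i 1) * (φ x) i := by
    conv_lhs => rw [← (EuclideanSpace.basisFun (Fin N) ℝ).sum_repr (φ x)]
    simp [mul_comm]
  rw [h1]
  unfold divergence
  rw [fderiv_fun_smul ha hφ, Finset.mul_sum, ← Finset.sum_add_distrib]
  refine Finset.sum_congr rfl fun i _ => ?_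
  simp

theorem divergence_smul_const {a : EuclideanSpace ℝ (Fin N) → ℝ} {x : EuclideanSpace ℝ (Fin N)}
    (ha : DifferentiableAt ℝ a x) (h : EuclideanSpace ℝ (Fin N)) :
    divergence (fun y => a y • h) x = fderiv ℝ a x h := by
  rw [divergence_smul ha (differentiableAt_const h)]
  simp [divergence]

theorem divergence_comp_add_right (ψ : EuclideanSpace ℝ (Fin N) → EuclideanSpace ℝ (Fin N))
    (h x : EuclideanSpace ℝ (Fin N)) :
    divergence (fun y => ψ (y + h)) x = divergence ψ (x + h) := by
  simp only [divergence, fderiv_comp_add_right]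

/-- Integration by parts against the constant 1 in each coordinate direction; later integrations by
parts reduce to this. -/
theorem integral_divergence_eq_zero {ψ : EuclideanSpace ℝ (Fin N) → EuclideanSpace ℝ (Fin N)}
    (hψ : ContDiff ℝ 1 ψ)
    (hc : HasCompactSupport ψ) : ∫ x, divergence ψ x = 0 := by
  have hd : Differentiable ℝ ψ := hψ.differentiable one_ne_zero
  have hcf : Continuous (fderiv ℝ ψ) := hψ.continuous_fderiv one_ne_zero
  have hint : ∀ i : Fin N,
      Integrable (fun x => (fderiv ℝ ψ x (EuclideanSpace.single i 1)) i) := by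
    intro i
    refine Continuous.integrable_of_hasCompactSupport (by fun_prop) ?_
    refine (hc.fderiv ℝ).mono ?_
    intro x hx h0
    exact hx (by simp [h0])
  unfold divergence
  rw [integral_finsetSum _ fun i _ => hint i]
  refine Finset.sum_eq_zero fun i _ => ?_
  have hdi : ∀ x, fderiv ℝ (fun y => ψ y i) x (EuclideanSpace.single i 1)
      = (fderiv ℝ ψ x (EuclideanSpace.single i 1)) i := by
    intro x
    have := ((EuclideanSpace.proj i : EuclideanSpace ℝ (Fin N) →L[ℝ] ℝ).hasFDerivAt.comp x (hd x).hasFDerivAt).fderiv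
    change fderiv ℝ ((EuclideanSpace.proj i : EuclideanSpace ℝ (Fin N) →L[ℝ] ℝ) ∘ ψ) x _ = _
    rw [this]; rfl
  have key := integral_mul_fderiv_eq_neg_fderiv_mul_of_integrable
      (μ := (volume : Measure (EuclideanSpace ℝ (Fin N))))
    (f := fun _ => (1 : ℝ)) (g := fun y => ψ y i) (v := EuclideanSpace.single i 1)
    (by simp) (by simpa [hdi] using hint i)
    (by
      simp only [one_mul]
      refine Continuous.integrable_of_hasCompactSupport (by fun_prop) (hc.mono ?_)
      intro x hx h0
      exact hx (by simp [h0]))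
    (fun x _ => by fun_prop) (fun x _ => by fun_prop)
  simpa [hdi] using key

theorem integral_sub_mul_eq (U D : EuclideanSpace ℝ (Fin N) → ℝ) (h : EuclideanSpace ℝ (Fin N)) :
    ∫ x, U (x - h) * D x = ∫ x, U x * D (x + h) := by
  rw [← integral_add_right_eq_self _ h]
  simp

/-- Mollification by a normalized bump function. -/
noncomputable def mollify (ρ : ContDiffBump (0 : EuclideanSpace ℝ (Fin N)))
    (U : EuclideanSpace ℝ (Fin N) → ℝ) : EuclideanSpace ℝ (Fin N) → ℝ :=
  ρ.normed volume ⋆[lsmul ℝ ℝ, volume] U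

theorem mollify_apply (ρ : ContDiffBump (0 : EuclideanSpace ℝ (Fin N)))
    (U : EuclideanSpace ℝ (Fin N) → ℝ) (x : EuclideanSpace ℝ (Fin N)) :
    mollify ρ U x = ∫ t, ρ.normed volume t * U (x - t) := by
  simp [mollify, convolution_def]

theorem mollify_apply_swap (ρ : ContDiffBump (0 : EuclideanSpace ℝ (Fin N)))
    (U : EuclideanSpace ℝ (Fin N) → ℝ) (x : EuclideanSpace ℝ (Fin N)) :
    mollify ρ U x = ∫ t, ρ.normed volume (x - t) * U t := by
  simp [mollify, convolution_eq_swap]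

theorem contDiff_mollify (ρ : ContDiffBump (0 : EuclideanSpace ℝ (Fin N)))
    {U : EuclideanSpace ℝ (Fin N) → ℝ} (hU : LocallyIntegrable U)
    (n : ℕ∞) : ContDiff ℝ n (mollify ρ U) :=
  ρ.hasCompactSupport_normed.contDiff_convolution_left _
    ρ.contDiff_normed hU

theorem abs_mollify_le (ρ : ContDiffBump (0 : EuclideanSpace ℝ (Fin N)))
    {U : EuclideanSpace ℝ (Fin N) → ℝ} {M : ℝ}
    (hU : ∀ᵐ x, |U x| ≤ M) (x : EuclideanSpace ℝ (Fin N)) : |mollify ρ U x| ≤ M := by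
  rw [mollify_apply_swap]
  have h1 : Integrable (fun t => ρ.normed volume (x - t) * M) :=
    ((ρ.integrable_normed (μ := volume)).comp_sub_left x).mul_const M
  rw [← Real.norm_eq_abs]
  refine (norm_integral_le_of_norm_le h1 ?_).trans_eq ?_
  · filter_upwards [hU] with t ht
    rw [norm_mul, Real.norm_of_nonneg (ρ.nonneg_normed _)]
    exact mul_le_mul_of_nonneg_left ht (ρ.nonneg_normed _)
  · rw [integral_mul_const, integral_sub_left_eq_self (ρ.normed volume) volume x,
      ρ.integral_normed, one_mul]

/-- A bound on the pairings of all small translates of `U` with `D` passes to mollifications. -/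
theorem integral_mollify_mul_le (ρ : ContDiffBump (0 : EuclideanSpace ℝ (Fin N)))
    {U D : EuclideanSpace ℝ (Fin N) → ℝ} (hU : Integrable U)
    (hD : AEStronglyMeasurable D) {M : ℝ} (hM : ∀ x, |D x| ≤ M) {c : ℝ}
    (h : ∀ t, ‖t‖ < ρ.rOut → ∫ x, U (x - t) * D x ≤ c) :
    ∫ x, mollify ρ U x * D x ≤ c := by
  have hprod : Integrable
      (fun p : EuclideanSpace ℝ (Fin N) × EuclideanSpace ℝ (Fin N) => ρ.normed volume p.2 * U (p.1 - p.2) * D p.1)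
      (volume.prod volume) := by
    have h1 := Integrable.convolution_integrand (lsmul ℝ ℝ : ℝ →L[ℝ] ℝ →L[ℝ] ℝ)
      (ρ.integrable_normed (μ := volume)) hU
    refine h1.mul_bdd (c := M) hD.comp_fst (Eventually.of_forall fun p => hM _)
  calc ∫ x, mollify ρ U x * D x
      = ∫ x, ∫ t, ρ.normed volume t * U (x - t) * D x := by
        simp_rw [mollify_apply, integral_mul_const]
    _ = ∫ t, ∫ x, ρ.normed volume t * U (x - t) * D x := integral_integral_swap hprod
    _ ≤ ∫ t, ρ.normed volume t * c := by
        refine integral_mono hprod.integral_prod_right (ρ.integrable_normed.mul_const c) ?_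
        intro t
        simp only [mul_assoc]
        rw [integral_const_mul]
        by_cases ht : ‖t‖ < ρ.rOut
        · exact mul_le_mul_of_nonneg_left (h t ht) (ρ.nonneg_normed _)
        · have : ρ.normed volume t = 0 := by
            by_contra h0
            have h2 : t ∈ Function.support (ρ.normed volume) := h0
            rw [ρ.support_normed_eq] at h2
            exact ht (by simpa using h2)
          simp [this]
    _ = c := by rw [integral_mul_const, ρ.integral_normed, one_mul]

/-- The bump functions of radius `1 / (n + 1)` used for mollification. -/
noncomputable def bumpSeq (N n : ℕ) : ContDiffBump (0 : EuclideanSpace ℝ (Fin N)) where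
  -- The ratio `rOut / rIn` stays equal to 2: almost everywhere convergence of the mollifications
  -- needs it bounded.
  rIn := 1 / (n + 1) / 2
  rOut := 1 / (n + 1)
  rIn_pos := by positivity
  rIn_lt_rOut := half_lt_self (by positivity)

theorem tendsto_bumpSeq_rOut : Tendsto (fun n => (bumpSeq N n).rOut) atTop (𝓝 0) :=
  tendsto_one_div_add_atTop_nhds_zero_nat

theorem ae_tendsto_mollify {U : EuclideanSpace ℝ (Fin N) → ℝ} (hU : LocallyIntegrable U) :
    ∀ᵐ x, Tendsto (fun n => mollify (bumpSeq N n) U x) atTop (𝓝 (U x)) :=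
  ContDiffBump.ae_convolution_tendsto_right_of_locallyIntegrable (K := 2) tendsto_bumpSeq_rOut
    (Eventually.of_forall fun n => by simp [bumpSeq]; linarith) hU

end Calculus

/-! ### Variation bounds under mollification and truncation. -/

section Variation

open Filter Topology

variable {N : ℕ}

/-- The distributional gradient of `U` has total mass at most `C` in `Ω`. -/
def VarLe (Ω : Set (EuclideanSpace ℝ (Fin N))) (U : EuclideanSpace ℝ (Fin N) → ℝ) (C : ℝ) : Prop :=
  ∀ ψ ∈ testFields Ω, ∫ x, U x * divergence ψ x ≤ C

variable {Ω : Set (EuclideanSpace ℝ (Fin N))} {U : EuclideanSpace ℝ (Fin N) → ℝ} {C δ : ℝ}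

theorem neg_mem_testFields {ψ : EuclideanSpace ℝ (Fin N) → EuclideanSpace ℝ (Fin N)}
    (hψ : ψ ∈ testFields Ω) : -ψ ∈ testFields Ω := by
  obtain ⟨h1, h2, h3, h4⟩ := hψ
  refine ⟨h1.neg, h2.neg, ?_, fun x => by simpa using h4 x⟩
  rwa [tsupport, Function.support_neg]

theorem VarLe.abs_integral_le (h : VarLe Ω U C)
    {ψ : EuclideanSpace ℝ (Fin N) → EuclideanSpace ℝ (Fin N)} (hψ : ψ ∈ testFields Ω) :
    |∫ x, U x * divergence ψ x| ≤ C := by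
  have h1 := h _ (neg_mem_testFields hψ)
  have h2 : ∀ x, divergence (-ψ) x = -divergence ψ x := fun x => by simp [divergence, fderiv_neg]
  simp only [h2, mul_neg, integral_neg] at h1
  exact abs_le.2 ⟨by linarith, h ψ hψ⟩

theorem comp_add_right_mem_testFields {ψ : EuclideanSpace ℝ (Fin N) → EuclideanSpace ℝ (Fin N)}
    (hψ : ContDiff ℝ 1 ψ)
    (hc : HasCompactSupport ψ) (hb : ∀ x, ‖ψ x‖ ≤ 1)
    (hS : Metric.thickening δ (tsupport ψ) ⊆ Ω) {h : EuclideanSpace ℝ (Fin N)} (hh : ‖h‖ < δ) :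
    (fun x => ψ (x + h)) ∈ testFields Ω := by
  refine ⟨by fun_prop, hc.comp_homeomorph (Homeomorph.addRight h), ?_, fun x => hb _⟩
  intro x hx
  have hx' : x + h ∈ tsupport ψ := by
    have := tsupport_comp_eq_preimage ψ (Homeomorph.addRight h)
    have h2 : x ∈ tsupport (ψ ∘ Homeomorph.addRight h) := hx
    rw [this] at h2
    exact h2
  exact hS (Metric.mem_thickening_iff.2 ⟨x + h, hx', by simpa using hh⟩)

/-- A mollification averages translates of `U`; each translation can be moved onto `ψ`, which
remains a test field because its support has room `δ` in `Ω`. -/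
theorem VarLe.integral_mollify_mul_divergence_le (h : VarLe Ω U C) (hU : Integrable U)
    {ψ : EuclideanSpace ℝ (Fin N) → EuclideanSpace ℝ (Fin N)} (hψ : ContDiff ℝ 1 ψ)
    (hc : HasCompactSupport ψ) (hb : ∀ x, ‖ψ x‖ ≤ 1)
    (hS : Metric.thickening δ (tsupport ψ) ⊆ Ω) (ρ : ContDiffBump (0 : EuclideanSpace ℝ (Fin N)))
    (hρ : ρ.rOut ≤ δ) :
    ∫ x, mollify ρ U x * divergence ψ x ≤ C := by
  obtain ⟨M, hM⟩ := exists_abs_divergence_le hψ hc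
  refine integral_mollify_mul_le ρ hU (continuous_divergence hψ).aestronglyMeasurable hM ?_
  intro t ht
  rw [integral_sub_mul_eq]
  simp only [← divergence_comp_add_right]
  exact h _ (comp_add_right_mem_testFields hψ hc hb hS (ht.trans_le hρ))

theorem tsupport_fun_smul_subset (a : EuclideanSpace ℝ (Fin N) → ℝ)
    (φ : EuclideanSpace ℝ (Fin N) → EuclideanSpace ℝ (Fin N)) :
    tsupport (fun y => a y • φ y) ⊆ tsupport φ :=
  closure_mono fun x hx h0 => hx (by simp [h0])

theorem hasCompactSupport_fun_smul {φ : EuclideanSpace ℝ (Fin N) → EuclideanSpace ℝ (Fin N)}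
    (hφ : HasCompactSupport φ) (a : EuclideanSpace ℝ (Fin N) → ℝ) :
    HasCompactSupport fun y => a y • φ y :=
  hφ.mono fun x hx h0 => hx (by simp [h0])

theorem contDiff_one_deriv {T : ℝ → ℝ} (hT : ContDiff ℝ 2 T) : ContDiff ℝ 1 (deriv T) := by
  rw [← one_add_one_eq_two, contDiff_succ_iff_deriv] at hT
  exact hT.2.2

/-- Integration by parts and the chain rule. -/
theorem integral_comp_mul_divergence {T : ℝ → ℝ} (hT : ContDiff ℝ 2 T)
    {g : EuclideanSpace ℝ (Fin N) → ℝ}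
    (hg : ContDiff ℝ 1 g) {φ : EuclideanSpace ℝ (Fin N) → EuclideanSpace ℝ (Fin N)}
    (hφ : ContDiff ℝ 1 φ) (hc : HasCompactSupport φ) :
    ∫ x, T (g x) * divergence φ x
      = ∫ x, g x * divergence (fun y => deriv T (g y) • φ y) x := by
  have hT' : ContDiff ℝ 1 (deriv T) := contDiff_one_deriv hT
  have hT1 : ContDiff ℝ 1 T := hT.of_le (by norm_num)
  have ha : ContDiff ℝ 1 fun x => T (g x) := hT1.comp hg
  have hb : ContDiff ℝ 1 fun x => deriv T (g x) := hT'.comp hg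
  have hψ : ContDiff ℝ 1 fun y => deriv T (g y) • φ y := hb.smul hφ
  have hψc : HasCompactSupport fun y => deriv T (g y) • φ y := hasCompactSupport_fun_smul hc _
  have hda := ha.differentiable one_ne_zero
  have hdg := hg.differentiable one_ne_zero
  have hdφ := hφ.differentiable one_ne_zero
  have hac : HasCompactSupport fun y => T (g y) • φ y := hasCompactSupport_fun_smul hc _
  have hgc : HasCompactSupport fun y => g y • deriv T
      (g y) • φ y := hasCompactSupport_fun_smul hψc _
  have haφ : ContDiff ℝ 1 fun y => T (g y) • φ y := ha.smul hφ
  have hgψ : ContDiff ℝ 1 fun y => g y • deriv T (g y) • φ y := hg.smul hψ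
  have e1 := integral_divergence_eq_zero haφ hac
  have e2 := integral_divergence_eq_zero hgψ hgc
  have hchain : ∀ x, fderiv ℝ (fun x => T (g x)) x (φ x) = deriv T (g x) * fderiv ℝ g x (φ x) := by
    intro x
    have := ((hT1.differentiable one_ne_zero (g x)).hasDerivAt.comp_hasFDerivAt x
      (hdg x).hasFDerivAt).fderiv
    change fderiv ℝ (T ∘ g) x _ = _
    rw [this]; rfl
  have i1 : Integrable fun x => divergence (fun y => T (g y) • φ y) x :=
    (continuous_divergence haφ).integrable_of_hasCompactSupport
      (hasCompactSupport_divergence hac)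
  have i2 : Integrable fun x => divergence (fun y => g y • (deriv T (g y) • φ y)) x :=
    (continuous_divergence hgψ).integrable_of_hasCompactSupport
      (hasCompactSupport_divergence hgc)
  have i3 : Integrable fun x => T (g x) * divergence φ x :=
    (ha.continuous.mul (continuous_divergence hφ)).integrable_of_hasCompactSupport
      (hasCompactSupport_divergence hc).mul_left
  have i4 : Integrable fun x => g x * divergence (fun y => deriv T (g y) • φ y) x :=
    (hg.continuous.mul (continuous_divergence hψ)).integrable_of_hasCompactSupport
      (hasCompactSupport_divergence hψc).mul_left
  -- The terms with `fderiv ℝ g` cancel, so the integrand is the difference of the divergences of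
  -- `T(g) φ` and `g T'(g) φ`.
  have e3 : ∫ x, (T (g x) * divergence φ x
      - g x * divergence (fun y => deriv T (g y) • φ y) x) = 0 := by
    have e0 := integral_sub i1 i2
    rw [e1, e2, sub_zero] at e0
    rw [← e0]
    congr 1
    ext x
    rw [divergence_smul (hda x) (hdφ x), hchain,
      divergence_smul (hdg x) (hψ.differentiable one_ne_zero x),
      map_smul, smul_eq_mul]
    ring
  rw [integral_sub i3 i4] at e3
  linarith

/-- A smooth approximation of the truncation to `[0, 1]`. -/
noncomputable def smoothClip (η s : ℝ) : ℝ :=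
  (1 + √(s ^ 2 + η ^ 2) - √((s - 1) ^ 2 + η ^ 2)) / 2

/-- The truncation to `[0, 1]`. -/
noncomputable def clip (s : ℝ) : ℝ := max 0 (min s 1)

/-- Truncation is `(1 + |s| - |s - 1|) / 2`; for `η ≠ 0` each absolute value `|t|` is smoothed to
`√(t ^ 2 + η ^ 2)`. -/
theorem smoothClip_zero (s : ℝ) : smoothClip 0 s = clip s := by
  simp only [smoothClip, ne_eq, OfNat.ofNat_ne_zero, not_false_eq_true, zero_pow, add_zero,
    Real.sqrt_sq_eq_abs, clip]
  rcases le_total s 0 with h | h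
  · rw [abs_of_nonpos h, abs_of_nonpos (by linarith), min_eq_left (by linarith), max_eq_left h]
    ring
  · rcases le_total s 1 with h1 | h1
    · rw [abs_of_nonneg h, abs_of_nonpos (by linarith), min_eq_left h1, max_eq_right h]
      ring
    · rw [abs_of_nonneg h, abs_of_nonneg (by linarith), min_eq_right h1, max_eq_right zero_le_one]
      ring

theorem continuous_smoothClip : Continuous fun p : ℝ × ℝ => smoothClip p.1 p.2 := by
  unfold smoothClip
  fun_prop

theorem continuous_clip : Continuous clip := by
  unfold clip
  fun_prop

theorem clip_mem_Icc (s : ℝ) : clip s ∈ Icc (0 : ℝ) 1 := by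
  simp [clip]

theorem contDiff_smoothClip {η : ℝ} (hη : η ≠ 0) : ContDiff ℝ 2 (smoothClip η) := by
  unfold smoothClip
  have h (s : ℝ) : s ^ 2 + η ^ 2 ≠ 0 := by positivity
  have h1 : ContDiff ℝ 2 fun s : ℝ => √(s ^ 2 + η ^ 2) :=
    ContDiff.sqrt (by fun_prop) fun s => h s
  have h2 : ContDiff ℝ 2 fun s : ℝ => √((s - 1) ^ 2 + η ^ 2) :=
    ContDiff.sqrt (by fun_prop) fun s => h (s - 1)
  exact ((contDiff_const.add h1).sub h2).div_const 2

/-- The derivative is half the difference of two numbers in `[-1, 1]`. This bound keeps `T'(g) φ` an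
admissible test field. -/
theorem abs_deriv_smoothClip_le {η : ℝ} (hη : η ≠ 0) (s : ℝ) : |deriv (smoothClip η) s| ≤ 1 := by
  have h (s : ℝ) : s ^ 2 + η ^ 2 ≠ 0 := by positivity
  have hq (a s : ℝ) : HasDerivAt (fun s : ℝ => √((s - a) ^ 2 + η ^ 2))
      ((s - a) / √((s - a) ^ 2 + η ^ 2)) s := by
    have := ((((hasDerivAt_id s).sub_const a).pow 2).add_const (η ^ 2)).sqrt (h (s - a))
    refine HasDerivAt.congr_deriv this ?_
    have h0 : √((s - a) ^ 2 + η ^ 2) ≠ 0 := (Real.sqrt_pos.2 (by positivity)).ne'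
    change ((2 : ℕ) : ℝ) * (s - a) ^ (2 - 1) * 1 / (2 * √((s - a) ^ 2 + η ^ 2)) = _
    field_simp
    norm_num [mul_comm]
  have hb (a s : ℝ) : |(s - a) / √((s - a) ^ 2 + η ^ 2)| ≤ 1 := by
    rw [abs_div, abs_of_nonneg (Real.sqrt_nonneg _)]
    refine div_le_one_of_le₀ (Real.abs_le_sqrt ?_) (Real.sqrt_nonneg _)
    nlinarith [sq_nonneg η]
  have hd : HasDerivAt (smoothClip η) (((s - 0) / √((s - 0) ^ 2 + η ^ 2)
      - (s - 1) / √((s - 1) ^ 2 + η ^ 2)) / 2) s := by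
    have := (((hq 0 s).const_add 1).sub (hq 1 s)).div_const 2
    simp only [sub_zero] at this ⊢
    exact this
  rw [hd.deriv]
  have h0 := abs_le.1 (hb 0 s)
  have h1 := abs_le.1 (hb 1 s)
  exact abs_le.2 ⟨by linarith, by linarith⟩

theorem abs_smoothClip_le (η s : ℝ) : |smoothClip η s| ≤ 1 := by
  have hA := Real.sq_sqrt (show 0 ≤ s ^ 2 + η ^ 2 by positivity)
  have hB := Real.sq_sqrt (show 0 ≤ (s - 1) ^ 2 + η ^ 2 by positivity)
  have hA1 := abs_le.1 (Real.abs_le_sqrt (show s ^ 2 ≤ s ^ 2 + η ^ 2 by nlinarith [sq_nonneg η]))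
  have hB1 := abs_le.1
    (Real.abs_le_sqrt (show (s - 1) ^ 2 ≤ (s - 1) ^ 2 + η ^ 2 by nlinarith [sq_nonneg η]))
  have hA0 := Real.sqrt_nonneg (s ^ 2 + η ^ 2)
  have hB0 := Real.sqrt_nonneg ((s - 1) ^ 2 + η ^ 2)
  have h1 : √(s ^ 2 + η ^ 2) ≤ √((s - 1) ^ 2 + η ^ 2) + 1 :=
    Real.sqrt_le_iff.2 ⟨by linarith, by nlinarith⟩
  have h2 : √((s - 1) ^ 2 + η ^ 2) ≤ √(s ^ 2 + η ^ 2) + 1 :=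
    Real.sqrt_le_iff.2 ⟨by linarith, by nlinarith⟩
  unfold smoothClip
  exact abs_le.2 ⟨by linarith, by linarith⟩

/-- Truncation does not increase the total variation. -/
theorem VarLe.clip (h : VarLe Ω U C) (hΩ : IsOpen Ω) (hU : Integrable U) :
    VarLe Ω (fun x => clip (U x)) C := by
  rintro φ ⟨hφ, hc, hsub, hb⟩
  obtain ⟨δ, hδ, hS⟩ := IsCompact.exists_thickening_subset_open hc hΩ hsub
  -- The mollification radius also serves as the smoothing parameter `η`, so a single limit removes
  -- both regularizations.
  have hlim : Tendsto (fun n => ∫ x, smoothClip (bumpSeq N n).rOut (mollify (bumpSeq N n) U x)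
      * divergence φ x) atTop (𝓝 (∫ x, ChanVese.clip (U x) * divergence φ x)) := by
    refine tendsto_integral_of_dominated_convergence (fun x => |divergence φ x|) ?_ ?_ ?_ ?_
    · intro n
      refine (Continuous.mul ?_ (continuous_divergence hφ)).aestronglyMeasurable
      exact continuous_smoothClip.comp (continuous_const.prodMk
        (contDiff_mollify _ hU.locallyIntegrable 0).continuous)
    · exact ((continuous_divergence hφ).integrable_of_hasCompactSupport
        (hasCompactSupport_divergence hc)).abs
    · refine fun n => Eventually.of_forall fun x => ?_
      rw [norm_mul]
      exact mul_le_of_le_one_left (norm_nonneg _) (abs_smoothClip_le _ _)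
    · filter_upwards [ae_tendsto_mollify hU.locallyIntegrable] with x hx
      rw [← smoothClip_zero]
      exact ((continuous_smoothClip.tendsto (0, U x)).comp
        ((tendsto_bumpSeq_rOut (N := N)).prodMk_nhds hx)).mul_const _
  refine le_of_tendsto hlim ?_
  filter_upwards [tendsto_bumpSeq_rOut.eventually_le_const hδ] with n hn
  have hη : (bumpSeq N n).rOut ≠ 0 := (bumpSeq N n).rOut_pos.ne'
  have hT := contDiff_smoothClip hη
  have hg : ContDiff ℝ 1 (mollify (bumpSeq N n) U) := contDiff_mollify _ hU.locallyIntegrable 1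
  have hT' := contDiff_one_deriv hT
  -- The chain rule moves the truncation onto the test field, as a factor of modulus at most 1 that
  -- does not enlarge the support.
  rw [integral_comp_mul_divergence hT hg hφ hc]
  refine h.integral_mollify_mul_divergence_le hU ((hT'.comp hg).smul hφ)
    (hasCompactSupport_fun_smul hc _) ?_ ?_ _ hn
  · intro x
    rw [Pi.smul_apply', norm_smul]
    exact mul_le_one₀ (abs_deriv_smoothClip_le hη _) (norm_nonneg _) (hb x)
  · exact (Metric.thickening_subset_of_subset _ (tsupport_fun_smul_subset _ _)).trans hS

end Variation

/-! ### Translation estimates in `L¹`. -/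

section Translation

open Filter Topology

variable {N : ℕ} {Ω : Set (EuclideanSpace ℝ (Fin N))} {U : EuclideanSpace ℝ (Fin N) → ℝ} {C δ : ℝ}

theorem VarLe.nonneg (h : VarLe Ω U C) : 0 ≤ C := by
  have := h 0 ⟨contDiff_const, HasCompactSupport.zero, by simp, by simp⟩
  simpa [divergence] using this

/-- The translation estimate, tested against a differentiable function. -/
theorem VarLe.abs_integral_translate_sub_le (hV : VarLe Ω U C) (hU : Integrable U)
    {φ : EuclideanSpace ℝ (Fin N) → ℝ} (hφ : ContDiff ℝ 1 φ) (hc : HasCompactSupport φ)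
    (hb : ∀ x, |φ x| ≤ 1) (hS : Metric.thickening δ (tsupport φ) ⊆ Ω)
    {h : EuclideanSpace ℝ (Fin N)} (hh : ‖h‖ < δ) :
    |(∫ x, U (x - h) * φ x) - ∫ x, U x * φ x| ≤ ‖h‖ * C := by
  rcases eq_or_ne h 0 with rfl | h0
  · simp
  have hn : 0 < ‖h‖ := norm_pos_iff.2 h0
  have hdφ : Differentiable ℝ φ := hφ.differentiable one_ne_zero
  have hcf : Continuous (fderiv ℝ φ) := hφ.continuous_fderiv one_ne_zero
  obtain ⟨M, hM⟩ := hcf.bounded_above_of_compact_support (hc.fderiv ℝ)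
  have hline (x : EuclideanSpace ℝ (Fin N)) (t : ℝ) :
      HasDerivAt (fun s : ℝ => U x * φ (x + s • h)) (U x * fderiv ℝ φ (x + t • h) h) t := by
    have h1 : HasDerivAt (fun s : ℝ => x + s • h) h t := by
      simpa using ((hasDerivAt_id t).smul_const h).const_add x
    exact ((hdφ _).hasFDerivAt.comp_hasDerivAt t h1).const_mul (U x)
  have hder (t : ℝ) : HasDerivAt (fun s : ℝ => ∫ x, U x * φ (x + s • h))
      (∫ x, U x * fderiv ℝ φ (x + t • h) h) t := by
    refine (hasDerivAt_integral_of_dominated_loc_of_deriv_le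
      (F := fun s x => U x * φ (x + s • h)) (F' := fun s x => U x * fderiv ℝ φ (x + s • h) h)
      (bound := fun x => |U x| * (M * ‖h‖)) univ_mem ?_ ?_ ?_ ?_ ?_ ?_).2
    · refine Eventually.of_forall fun s => hU.aestronglyMeasurable.mul ?_
      have := hφ.continuous
      exact (by fun_prop : Continuous fun x => φ (x + s • h)).aestronglyMeasurable
    · have := hφ.continuous
      exact hU.mul_bdd (c := 1)
        (by fun_prop : Continuous fun x => φ (x + t • h)).aestronglyMeasurable
        (Eventually.of_forall fun x => hb _)
    · refine hU.aestronglyMeasurable.mul ?_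
      exact (by fun_prop : Continuous fun x => fderiv ℝ φ (x + t • h) h).aestronglyMeasurable
    · refine Eventually.of_forall fun x s _ => ?_
      rw [norm_mul, Real.norm_eq_abs]
      refine mul_le_mul_of_nonneg_left ?_ (abs_nonneg _)
      exact ((fderiv ℝ φ _).le_opNorm h).trans
        (mul_le_mul_of_nonneg_right (hM _) (norm_nonneg _))
    · exact hU.abs.mul_const _
    · exact Eventually.of_forall fun x s _ => hline x s
  -- The derivative of `φ` along `h` is `‖h‖` times the divergence of this field, so the pairing
  -- changes at speed at most `‖h‖ * C` along the segment from 0 to `h`.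
  set ψ : EuclideanSpace ℝ (Fin N) → EuclideanSpace ℝ (Fin N) :=
    fun x => φ x • (‖h‖⁻¹ • h) with hψdef
  have hψ : ContDiff ℝ 1 ψ := hφ.smul contDiff_const
  have hsub : Function.support ψ ⊆ Function.support φ := fun x hx h0 => hx (by simp [hψdef, h0])
  have hψc : HasCompactSupport ψ := hc.mono hsub
  have hψb (x) : ‖ψ x‖ ≤ 1 := by
    rw [hψdef, norm_smul, norm_smul, norm_inv, norm_norm, inv_mul_cancel₀ hn.ne', mul_one]
    exact hb x
  have hψS : Metric.thickening δ (tsupport ψ) ⊆ Ω :=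
    (Metric.thickening_subset_of_subset _ (closure_mono hsub)).trans hS
  have hbound : ∀ t ∈ Ico (0 : ℝ) 1, ‖∫ x, U x * fderiv ℝ φ (x + t • h) h‖ ≤ ‖h‖ * C := by
    intro t ht
    have hth : ‖t • h‖ < δ := by
      refine lt_of_le_of_lt ?_ hh
      rw [norm_smul, Real.norm_of_nonneg ht.1]
      exact mul_le_of_le_one_left (norm_nonneg _) ht.2.le
    have h1 := hV.abs_integral_le (comp_add_right_mem_testFields hψ hψc hψb hψS hth)
    have h2 (x) : U x * fderiv ℝ φ (x + t • h) h
        = ‖h‖ * (U x * divergence (fun y => ψ (y + t • h)) x) := by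
      rw [divergence_comp_add_right, hψdef, divergence_smul_const (hdφ _), map_smul, smul_eq_mul]
      field_simp
    simp only [h2]
    rw [integral_const_mul, norm_mul, norm_norm]
    exact mul_le_mul_of_nonneg_left h1 hn.le
  have key := norm_image_sub_le_of_norm_deriv_le_segment_01'
    (fun t _ => (hder t).hasDerivWithinAt) hbound
  rw [integral_sub_mul_eq]
  simpa using key

/-- The translation estimate, tested against a bounded function with a smooth cutoff. -/
theorem VarLe.integral_translate_cutoff_le (hV : VarLe Ω U C) (hU : Integrable U)
    {χ w : EuclideanSpace ℝ (Fin N) → ℝ} (hχ : ContDiff ℝ 1 χ) (hc : HasCompactSupport χ)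
    (hχb : ∀ x, |χ x| ≤ 1) (hS : Metric.thickening δ (tsupport χ) ⊆ Ω)
    (hw : AEStronglyMeasurable w) (hwb : ∀ x, |w x| ≤ 1)
    {h : EuclideanSpace ℝ (Fin N)} (hh : ‖h‖ < δ) :
    ∫ x, U (x - h) * (χ x * w x) ≤ ‖h‖ * C + ∫ x, U x * (χ x * w x) := by
  have hwl : LocallyIntegrable w := by
    refine (locallyIntegrable_const (1 : ℝ)).mono hw (Eventually.of_forall fun x => ?_)
    simpa using hwb x
  -- Mollifying `w` preserves its bound and the factor `χ` confines the support, so the smooth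
  -- estimate applies and passes to the limit.
  have hm (n) : ContDiff ℝ 1 (mollify (bumpSeq N n) w) := contDiff_mollify _ hwl 1
  have hmb (n x) : |mollify (bumpSeq N n) w x| ≤ 1 :=
    abs_mollify_le _ (Eventually.of_forall hwb) x
  have hb (n x) : |χ x * mollify (bumpSeq N n) w x| ≤ 1 := by
    rw [abs_mul]
    exact mul_le_one₀ (hχb x) (abs_nonneg _) (hmb n x)
  have hlim {V : EuclideanSpace ℝ (Fin N) → ℝ} (hVi : Integrable V) :
      Tendsto (fun n => ∫ x, V x * (χ x * mollify (bumpSeq N n) w x)) atTop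
        (𝓝 (∫ x, V x * (χ x * w x))) := by
    refine tendsto_integral_of_dominated_convergence (fun x => |V x|) ?_ hVi.abs ?_ ?_
    · exact fun n => hVi.aestronglyMeasurable.mul
        (hχ.continuous.mul (hm n).continuous).aestronglyMeasurable
    · refine fun n => Eventually.of_forall fun x => ?_
      rw [norm_mul]
      exact mul_le_of_le_one_right (norm_nonneg _) (hb n x)
    · filter_upwards [ae_tendsto_mollify hwl] with x hx
      exact (hx.const_mul _).const_mul _
  have h1 := hlim (hU.comp_sub_right h)
  have h2 := (hlim hU).const_add (‖h‖ * C)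
  refine le_of_tendsto_of_tendsto' h1 h2 fun n => ?_
  have hsub : Function.support (fun x => χ x * mollify (bumpSeq N n) w x) ⊆ Function.support χ :=
    fun x hx h0 => hx (by simp [h0])
  have := (abs_le.1 (hV.abs_integral_translate_sub_le hU (hχ.mul (hm n)) (hc.mono hsub) (hb n)
    ((Metric.thickening_subset_of_subset _ (closure_mono hsub)).trans hS) hh)).2
  linarith

/-- Mollification at scale `r` moves a function of variation `C` by at most `r * C` in `L¹`. -/
theorem VarLe.integral_cutoff_mul_abs_mollify_sub_le (hV : VarLe Ω U C) (hU : Integrable U)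
    {χ : EuclideanSpace ℝ (Fin N) → ℝ} (hχ : ContDiff ℝ 1 χ) (hc : HasCompactSupport χ)
    (hχb : ∀ x, |χ x| ≤ 1) (hS : Metric.thickening δ (tsupport χ) ⊆ Ω)
    (ρ : ContDiffBump (0 : EuclideanSpace ℝ (Fin N))) (hρ : ρ.rOut ≤ δ) :
    ∫ x, χ x * |mollify ρ U x - U x| ≤ ρ.rOut * C := by
  -- Testing against the sign of `mollify ρ U - U` turns the pairing into the `L¹` norm; the value
  -- at 0 is immaterial.
  set s : ℝ → ℝ := fun t => if 0 ≤ t then 1 else -1 with hs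
  have hsm : Measurable s := Measurable.ite measurableSet_Ici measurable_const measurable_const
  have hsb (t) : |s t| ≤ 1 := by simp only [hs]; split_ifs <;> simp
  have hst (t) : t * s t = |t| := by
    simp only [hs]
    split_ifs with h
    · rw [abs_of_nonneg h, mul_one]
    · rw [abs_of_neg (not_le.1 h)]; ring
  set w := fun x => s (mollify ρ U x - U x) with hwdef
  have hmc : Continuous (mollify ρ U) := (contDiff_mollify ρ hU.locallyIntegrable 0).continuous
  have hw : AEStronglyMeasurable w :=
    (hsm.comp_aemeasurable
      (hmc.aemeasurable.sub hU.aestronglyMeasurable.aemeasurable)).aestronglyMeasurable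
  have hD : AEStronglyMeasurable fun x => χ x * w x := hχ.continuous.aestronglyMeasurable.mul hw
  have hDb (x) : |χ x * w x| ≤ 1 := by
    rw [abs_mul]
    exact mul_le_one₀ (hχb x) (abs_nonneg _) (hsb _)
  have hDi : Integrable fun x => χ x * w x :=
    (hχ.continuous.integrable_of_hasCompactSupport hc).mul_bdd (c := 1) hw
      (Eventually.of_forall fun x => hsb _)
  have key := integral_mollify_mul_le ρ hU hD hDb (c := ρ.rOut * C + ∫ x, U x * (χ x * w x)) (by
    intro t ht
    refine (hV.integral_translate_cutoff_le hU hχ hc hχb hS hw (fun x => hsb _)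
      (ht.trans_le hρ)).trans ?_
    have := mul_le_mul_of_nonneg_right ht.le hV.nonneg
    linarith)
  have i1 : Integrable fun x => U x * (χ x * w x) :=
    hU.mul_bdd (c := 1) hD (Eventually.of_forall hDb)
  have i2 : Integrable fun x => mollify ρ U x * (χ x * w x) := by
    have h1 : Integrable fun x => mollify ρ U x * χ x :=
      (hmc.mul hχ.continuous).integrable_of_hasCompactSupport hc.mul_left
    have h2 := h1.mul_bdd (c := 1) hw (Eventually.of_forall fun x => hsb _)
    simpa only [mul_assoc] using h2
  have e : ∫ x, χ x * |mollify ρ U x - U x|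
      = (∫ x, mollify ρ U x * (χ x * w x)) - ∫ x, U x * (χ x * w x) := by
    rw [← integral_sub i2 i1]
    congr 1
    ext x
    rw [← hst, hwdef]
    ring
  linarith

end Translation

/-! ### Compactness for bounded variation and values in `[0, 1]`. -/

section Compactness

open Filter Topology

variable {N : ℕ} {Ω : Set (EuclideanSpace ℝ (Fin N))}

/-- Bounded sequences in a separable Hilbert space have weakly convergent subsequences. -/
theorem exists_subseq_tendsto_inner {H : Type*} [NormedAddCommGroup H] [InnerProductSpace ℝ H]
    [CompleteSpace H] [TopologicalSpace.SeparableSpace H] {u : ℕ → H} {R : ℝ}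
    (hu : ∀ n, ‖u n‖ ≤ R) :
    ∃ (v : H) (σ : ℕ → ℕ), StrictMono σ ∧
      ∀ w, Tendsto (fun n => inner ℝ (u (σ n)) w) atTop (𝓝 (inner ℝ v w)) := by
  have hmem (n) : StrongDual.toWeakDual (InnerProductSpace.toDual ℝ H (u n)) ∈
      (WeakDual.toStrongDual ⁻¹' Metric.closedBall 0 R : Set (WeakDual ℝ H)) := by
    change InnerProductSpace.toDual ℝ H (u n) ∈ Metric.closedBall 0 R
    rw [mem_closedBall_zero_iff, LinearIsometryEquiv.norm_map]
    exact hu n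
  obtain ⟨ℓ, -, σ, hσ, hlim⟩ := WeakDual.isSeqCompact_closedBall ℝ H 0 R hmem
  refine ⟨(InnerProductSpace.toDual ℝ H).symm (WeakDual.toStrongDual ℓ), σ, hσ, fun w => ?_⟩
  rw [InnerProductSpace.toDual_symm_apply]
  exact ((WeakDual.eval_continuous w).tendsto ℓ).comp hlim

/-- A smooth function with values in `[0, 1]` which is one on a compact set and has compact support
in a given open neighbourhood. -/
theorem exists_smooth_cutoff {K : Set (EuclideanSpace ℝ (Fin N))} (hΩ : IsOpen Ω)
    (hK : IsCompact K) (hKΩ : K ⊆ Ω) :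
    ∃ χ : EuclideanSpace ℝ (Fin N) → ℝ, ContDiff ℝ 1 χ ∧ HasCompactSupport χ ∧ tsupport χ ⊆ Ω ∧
      (∀ x, χ x ∈ Icc (0 : ℝ) 1) ∧ ∀ x ∈ K, χ x = 1 := by
  obtain ⟨δ, hδ, hS⟩ := hK.exists_cthickening_subset_open hΩ hKΩ
  obtain ⟨χ, h1, h2, h3, h4⟩ := exists_contMDiff_support_eq_eq_one_iff (n := 1)
    (modelWithCornersSelf ℝ (EuclideanSpace ℝ (Fin N)))
    (Metric.isOpen_thickening (δ := δ) (E := K)) hK.isClosed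
    (Metric.self_subset_thickening hδ K)
  have hsub : tsupport χ ⊆ Metric.cthickening δ K := by
    rw [tsupport, h3]
    exact Metric.closure_thickening_subset_cthickening δ K
  exact ⟨χ, h1.contDiff, (hK.cthickening).of_isClosed_subset (isClosed_tsupport _) hsub,
    hsub.trans hS, fun x => h2 ⟨x, rfl⟩, fun x hx => (h4 x).1 hx⟩

/-- Weak convergence improves to local convergence in `L¹` under a uniform bound on the
variations. -/
theorem tendsto_integral_cutoff_mul_abs_sub (hΩ : IsOpen Ω)
    {U : ℕ → EuclideanSpace ℝ (Fin N) → ℝ} {V : EuclideanSpace ℝ (Fin N) → ℝ} {C : ℝ}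
    (hU : ∀ n, Integrable (U n)) (hV : Integrable V) (hUb : ∀ n, ∀ᵐ x, |U n x| ≤ 1)
    (hUC : ∀ n, VarLe Ω (U n) C) (hVC : VarLe Ω V C)
    (hw : ∀ g : EuclideanSpace ℝ (Fin N) → ℝ, Continuous g → HasCompactSupport g →
      Tendsto (fun n => ∫ x, U n x * g x) atTop (𝓝 (∫ x, V x * g x)))
    {χ : EuclideanSpace ℝ (Fin N) → ℝ} (hχ : ContDiff ℝ 1 χ) (hc : HasCompactSupport χ)
    (hχΩ : tsupport χ ⊆ Ω) (hχb : ∀ x, χ x ∈ Icc (0 : ℝ) 1) :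
    Tendsto (fun n => ∫ x, χ x * |U n x - V x|) atTop (𝓝 0) := by
  obtain ⟨δ, hδ, hS⟩ := IsCompact.exists_thickening_subset_open hc hΩ hχΩ
  have hχa (x) : |χ x| ≤ 1 := abs_le.2 ⟨by linarith [(hχb x).1], (hχb x).2⟩
  have hmc (ρ : ContDiffBump (0 : EuclideanSpace ℝ (Fin N))) {W : EuclideanSpace ℝ (Fin N) → ℝ}
      (hW : Integrable W) : Continuous (mollify ρ W) :=
    (contDiff_mollify ρ hW.locallyIntegrable 0).continuous
  have hint {F G : EuclideanSpace ℝ (Fin N) → ℝ} (hF : LocallyIntegrable F)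
      (hG : LocallyIntegrable G) : Integrable fun x => χ x * |F x - G x| := by
    have h1 := (LocallyIntegrable.sub hF hG).integrable_smul_left_of_hasCompactSupport
      hχ.continuous hc
    refine h1.norm.congr (Eventually.of_forall fun x => ?_)
    simp [abs_of_nonneg (hχb x).1]
  -- At a fixed scale, the mollification at `x` is a pairing with one fixed continuous function, so
  -- weak convergence gives pointwise convergence.
  have hmoll (ρ : ContDiffBump (0 : EuclideanSpace ℝ (Fin N))) :
      Tendsto (fun n => ∫ x, χ x * |mollify ρ (U n) x - mollify ρ V x|) atTop (𝓝 0) := by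
    have h0 : (0 : ℝ) = ∫ x : EuclideanSpace ℝ (Fin N), χ x * |mollify ρ V x - mollify ρ V x| := by
      simp
    rw [h0]
    refine tendsto_integral_of_dominated_convergence
      (fun x => χ x * (1 + |mollify ρ V x|)) ?_ ?_ ?_ ?_
    · intro n
      have h1 := hmc ρ (hU n)
      have h2 := hmc ρ hV
      have h3 := hχ.continuous
      exact (by fun_prop : Continuous fun x =>
        χ x * |mollify ρ (U n) x - mollify ρ V x|).aestronglyMeasurable
    · have h2 := hmc ρ hV
      have h3 := hχ.continuous
      exact (by fun_prop : Continuous fun x =>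
        χ x * (1 + |mollify ρ V x|)).integrable_of_hasCompactSupport hc.mul_right
    · refine fun n => Eventually.of_forall fun x => ?_
      rw [Real.norm_eq_abs, abs_mul, abs_abs, abs_of_nonneg (hχb x).1]
      refine mul_le_mul_of_nonneg_left ?_ (hχb x).1
      exact (abs_sub _ _).trans (add_le_add_left (abs_mollify_le ρ (hUb n) x) _)
    · refine Eventually.of_forall fun x => ?_
      have hx : Tendsto (fun n => mollify ρ (U n) x) atTop (𝓝 (mollify ρ V x)) := by
        simp only [mollify_apply_swap, mul_comm (ρ.normed volume _)]
        refine hw _ (ρ.continuous_normed.comp (by fun_prop)) ?_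
        exact ρ.hasCompactSupport_normed.comp_homeomorph (Homeomorph.subLeft x)
      exact ((hx.sub_const _).abs).const_mul _
  rw [Metric.tendsto_atTop']
  intro κ hκ
  -- Both `U n` and `V` are replaced by mollifications, hence the factor 2; these errors use up half
  -- of `κ`.
  have hr : Tendsto (fun m => 2 * ((bumpSeq N m).rOut * C)) atTop (𝓝 0) := by
    simpa using ((tendsto_bumpSeq_rOut (N := N)).mul_const C).const_mul 2
  obtain ⟨m, hm1, hm2⟩ := ((hr.eventually_lt_const (half_pos hκ)).and
    ((tendsto_bumpSeq_rOut (N := N)).eventually_le_const hδ)).exists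
  obtain ⟨n₀, hn₀⟩ := eventually_atTop.1 ((hmoll (bumpSeq N m)).eventually_lt_const (half_pos hκ))
  refine ⟨n₀, fun n hn => ?_⟩
  have hnn : 0 ≤ ∫ x, χ x * |U n x - V x| :=
    integral_nonneg fun x => mul_nonneg (hχb x).1 (abs_nonneg _)
  rw [dist_zero_right, Real.norm_of_nonneg hnn]
  have e1 := (hUC n).integral_cutoff_mul_abs_mollify_sub_le (hU n) hχ hc hχa hS _ hm2
  have e2 := hVC.integral_cutoff_mul_abs_mollify_sub_le hV hχ hc hχa hS _ hm2
  have e3 := hn₀ n hn.le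
  have i1 := hint (hmc (bumpSeq N m) (hU n)).locallyIntegrable (hU n).locallyIntegrable
  have i2 := hint (hmc (bumpSeq N m) hV).locallyIntegrable hV.locallyIntegrable
  have i3 := hint (hmc (bumpSeq N m) (hU n)).locallyIntegrable
    (hmc (bumpSeq N m) hV).locallyIntegrable
  have e4 := integral_mono (hint (hU n).locallyIntegrable hV.locallyIntegrable)
    ((i1.add i2).add i3) (fun x => by
      have a1 := abs_sub_le (U n x) (mollify (bumpSeq N m) (U n) x) (V x)
      have a2 := abs_sub_le (mollify (bumpSeq N m) (U n) x) (mollify (bumpSeq N m) V x) (V x)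
      rw [abs_sub_comm (U n x) (mollify (bumpSeq N m) (U n) x)] at a1
      simp only [Pi.add_apply, ← mul_add]
      exact mul_le_mul_of_nonneg_left (by linarith) (hχb x).1)
  rw [integral_add' (i1.add i2) i3, integral_add' i1 i2] at e4
  linarith

theorem integral_indicator_mul (hΩ : IsOpen Ω) (u g : EuclideanSpace ℝ (Fin N) → ℝ) :
    ∫ x, Ω.indicator u x * g x = ∫ x in Ω, u x * g x := by
  rw [← integral_indicator hΩ.measurableSet]
  congr 1
  ext x
  rw [indicator_mul_left]

/-- Compactness of sets of functions with values in `[0, 1]` and bounded variation. -/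
theorem exists_subseq_tendsto_ae (hΩ : IsOpen Ω) (hb : Bornology.IsBounded Ω)
    {u : ℕ → Lp ℝ 2 (volume.restrict Ω)} {C : ℝ}
    (h01 : ∀ n, ∀ᵐ x ∂(volume.restrict Ω), u n x ∈ Icc (0 : ℝ) 1)
    (hC : ∀ n, VarLe Ω (Ω.indicator (u n)) C) :
    ∃ (v : Lp ℝ 2 (volume.restrict Ω)) (σ : ℕ → ℕ), StrictMono σ ∧
      (∀ᵐ x ∂(volume.restrict Ω), v x ∈ Icc (0 : ℝ) 1) ∧
      ∀ᵐ x ∂(volume.restrict Ω), Tendsto (fun k => u (σ k) x) atTop (𝓝 (v x)) := by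
  have hfin : IsFiniteMeasure (volume.restrict Ω) := isFiniteMeasure_restrict.2 hb.measure_lt_top.ne
  have h2 : Fact ((2 : ℝ≥0∞) ≠ ∞) := ⟨ENNReal.ofNat_ne_top⟩
  obtain ⟨v, σ, hσ, hweak⟩ := exists_subseq_tendsto_inner (u := u)
    (fun n => Lp.norm_le_of_ae_bound zero_le_one ((h01 n).mono fun x hx =>
      abs_le.2 ⟨by linarith [hx.1], hx.2⟩))
  have hw {g : EuclideanSpace ℝ (Fin N) → ℝ} (hg : MemLp g 2 (volume.restrict Ω)) :
      Tendsto (fun n => ∫ x in Ω, u (σ n) x * g x) atTop (𝓝 (∫ x in Ω, v x * g x)) := by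
    have e (w : Lp ℝ 2 (volume.restrict Ω)) :
        inner ℝ w (hg.toLp g) = ∫ x in Ω, w x * g x := by
      rw [L2.inner_def]
      refine integral_congr_ae (hg.coeFn_toLp.mono fun x hx => ?_)
      simp [hx, mul_comm]
    simpa only [e] using hweak (hg.toLp g)
  have hi (w : Lp ℝ 2 (volume.restrict Ω)) : Integrable w (volume.restrict Ω) :=
    (Lp.memLp w).integrable one_le_two
  have hI (w : Lp ℝ 2 (volume.restrict Ω)) : Integrable (Ω.indicator w) :=
    (integrable_indicator_iff hΩ.measurableSet).2 (hi w)
  have hset {s : Set (EuclideanSpace ℝ (Fin N))} (hs : MeasurableSet s) :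
      Tendsto (fun n => ∫ x in s, u (σ n) x ∂(volume.restrict Ω)) atTop
        (𝓝 (∫ x in s, v x ∂(volume.restrict Ω))) := by
    have e (w : EuclideanSpace ℝ (Fin N) → ℝ) :
        ∫ x in Ω, w x * s.indicator (fun _ => (1 : ℝ)) x
          = ∫ x in s, w x ∂(volume.restrict Ω) := by
      rw [← integral_indicator hs]
      congr 1
      ext x
      by_cases hx : x ∈ s <;> simp [hx]
    simpa only [e] using hw ((memLp_const (1 : ℝ)).indicator hs)
  -- Bounds survive weak convergence: test against indicators of measurable sets.
  have hv0 : ∀ᵐ x ∂(volume.restrict Ω), 0 ≤ v x := by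
    refine ae_nonneg_of_forall_setIntegral_nonneg (hi v) fun s hs _ => ?_
    refine ge_of_tendsto' (hset hs) fun n => ?_
    exact integral_nonneg_of_ae ((ae_restrict_of_ae (h01 (σ n))).mono fun x hx => hx.1)
  have hv1 : ∀ᵐ x ∂(volume.restrict Ω), v x ≤ 1 := by
    refine ae_le_of_forall_setIntegral_le (hi v) (integrable_const 1) fun s hs _ => ?_
    refine le_of_tendsto' (hset hs) fun n => ?_
    exact integral_mono_ae (hi _).integrableOn (integrable_const 1)
      ((ae_restrict_of_ae (h01 (σ n))).mono fun x hx => hx.2)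
  have hv : ∀ᵐ x ∂(volume.restrict Ω), v x ∈ Icc (0 : ℝ) 1 := by
    filter_upwards [hv0, hv1] with x h0 h1 using ⟨h0, h1⟩
  have hwg (g : EuclideanSpace ℝ (Fin N) → ℝ) (hg : Continuous g) (hgc : HasCompactSupport g) :
      Tendsto (fun n => ∫ x, Ω.indicator (u (σ n)) x * g x) atTop
        (𝓝 (∫ x, Ω.indicator v x * g x)) := by
    simp only [integral_indicator_mul hΩ]
    exact hw ((hg.memLp_of_hasCompactSupport hgc).restrict Ω)
  have hVC : VarLe Ω (Ω.indicator v) C := fun ψ hψ =>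
    le_of_tendsto' (hwg _ (continuous_divergence hψ.1) (hasCompactSupport_divergence hψ.2.1))
      fun n => hC _ ψ hψ
  have hUb (w : Lp ℝ 2 (volume.restrict Ω))
      (hw : ∀ᵐ x ∂(volume.restrict Ω), w x ∈ Icc (0 : ℝ) 1) :
      ∀ᵐ x, Ω.indicator w x ∈ Icc (0 : ℝ) 1 := by
    filter_upwards [(ae_restrict_iff' hΩ.measurableSet).1 hw] with x hx
    by_cases hxΩ : x ∈ Ω
    · simpa [hxΩ] using hx hxΩ
    · simp [hxΩ]
  have hL1 : Tendsto (fun n => ∫ x, |Ω.indicator (u (σ n)) x - Ω.indicator v x|) atTop (𝓝 0) := by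
    rw [Metric.tendsto_atTop']
    intro κ hκ
    -- Outside `K` the integrand is at most 1 and lives on a set of measure below `κ / 2`; on `K`
    -- the cutoff equals 1.
    obtain ⟨K, hKΩ, hK, hKm⟩ := hΩ.measurableSet.exists_isCompact_sdiff_lt (μ := volume)
      hb.measure_lt_top.ne (ε := ENNReal.ofReal (κ / 2)) (by simpa using hκ)
    obtain ⟨χ, hχ, hχc, hχΩ, hχb, hχK⟩ := exists_smooth_cutoff hΩ hK hKΩ
    have hlim := tendsto_integral_cutoff_mul_abs_sub hΩ (fun n => hI (u (σ n))) (hI v)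
      (fun n => (hUb _ (h01 (σ n))).mono fun x hx => abs_le.2 ⟨by linarith [hx.1], hx.2⟩)
      (fun n => hC _) hVC hwg hχ hχc hχΩ hχb
    obtain ⟨n₀, hn₀⟩ := eventually_atTop.1 (hlim.eventually_lt_const (half_pos hκ))
    refine ⟨n₀, fun n hn => ?_⟩
    rw [dist_zero_right, Real.norm_of_nonneg (integral_nonneg fun x => abs_nonneg _)]
    have hdm : MeasurableSet (Ω \ K) := hΩ.measurableSet.diff hK.measurableSet
    have hdi : Integrable ((Ω \ K).indicator fun _ => (1 : ℝ)) :=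
      (integrable_indicator_iff hdm).2 (integrableOn_const (hKm.trans ENNReal.ofReal_lt_top).ne)
    have hdv : ∫ x, (Ω \ K).indicator (fun _ => (1 : ℝ)) x < κ / 2 := by
      rw [integral_indicator hdm]
      simp only [integral_const, smul_eq_mul, mul_one, measureReal_restrict_apply_univ]
      exact (ENNReal.toReal_lt_of_lt_ofReal hKm)
    have hsub := (hI (u (σ n))).sub (hI v)
    have hχi : Integrable fun x => χ x * |Ω.indicator (u (σ n)) x - Ω.indicator v x| :=
      hsub.abs.bdd_mul (c := 1) hχ.continuous.aestronglyMeasurable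
        (Eventually.of_forall fun x => abs_le.2 ⟨by linarith [(hχb x).1], (hχb x).2⟩)
    have key := integral_mono_ae hsub.abs (hχi.add hdi) (by
      filter_upwards [hUb _ (h01 (σ n)), hUb _ hv] with x h1 h2
      simp only [Pi.add_apply, Pi.sub_apply]
      by_cases hxΩ : x ∈ Ω
      · by_cases hxK : x ∈ K
        · simp [hxK, hχK x hxK]
        · rw [indicator_of_mem (show x ∈ Ω \ K from ⟨hxΩ, hxK⟩)]
          have := mul_nonneg (hχb x).1 (abs_nonneg (Ω.indicator (u (σ n)) x - Ω.indicator v x))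
          have : |Ω.indicator (u (σ n)) x - Ω.indicator v x| ≤ 1 :=
            abs_le.2 ⟨by linarith [h1.1, h2.2], by linarith [h1.2, h2.1]⟩
          linarith
      · simp [hxΩ])
    rw [integral_add' hχi hdi] at key
    have := hn₀ n hn.le
    simp only [Pi.sub_apply] at key
    linarith
  have hm : TendstoInMeasure (volume.restrict Ω) (fun n => (u (σ n) : EuclideanSpace ℝ (Fin N) → ℝ))
      atTop v := by
    refine tendstoInMeasure_of_tendsto_eLpNorm one_ne_zero
      (fun n => Lp.aestronglyMeasurable _) (Lp.aestronglyMeasurable _) ?_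
    have e (n) : eLpNorm
        ((u (σ n) : EuclideanSpace ℝ (Fin N) → ℝ) - (v : EuclideanSpace ℝ (Fin N) → ℝ)) 1
        (volume.restrict Ω)
        = ENNReal.ofReal (∫ x, |Ω.indicator (u (σ n)) x - Ω.indicator v x|) := by
      rw [eLpNorm_one_eq_lintegral_enorm, ← ofReal_integral_norm_eq_lintegral_enorm
        ((hi _).sub (hi _)), ← integral_indicator hΩ.measurableSet]
      congr 2
      ext x
      by_cases hx : x ∈ Ω <;> simp [hx]
    simp only [e]
    simpa using ENNReal.tendsto_ofReal hL1
  obtain ⟨τ, hτ, hae⟩ := hm.exists_seq_tendsto_ae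
  exact ⟨v, σ ∘ τ, hσ.comp hτ, hv, hae⟩

end Compactness

/-! ### Lower semicontinuity and the direct method. -/

section Energy

open Filter Topology

variable {N : ℕ} {Ω : Set (EuclideanSpace ℝ (Fin N))}

theorem totalVariation_congr_ae {u v : EuclideanSpace ℝ (Fin N) → ℝ}
    (h : u =ᵐ[volume.restrict Ω] v) : totalVariation Ω u = totalVariation Ω v := by
  unfold totalVariation
  refine iSup_congr fun φ => iSup_congr fun _ => ?_
  congr 1
  exact integral_congr_ae (h.mono fun x hx => by simp only [hx])

theorem totalVariation_le_ofReal_iff (hΩ : IsOpen Ω) {u : EuclideanSpace ℝ (Fin N) → ℝ} {C : ℝ}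
    (hC : 0 ≤ C) : totalVariation Ω u ≤ ENNReal.ofReal C ↔ VarLe Ω (Ω.indicator u) C := by
  simp only [totalVariation, iSup₂_le_iff, VarLe, integral_indicator_mul hΩ,
    ENNReal.ofReal_le_ofReal_iff hC]

theorem totalVariation_clip_le (hΩ : IsOpen Ω) {u : EuclideanSpace ℝ (Fin N) → ℝ}
    (hu : IntegrableOn u Ω) : totalVariation Ω (fun x => clip (u x)) ≤ totalVariation Ω u := by
  rcases eq_or_ne (totalVariation Ω u) ∞ with h | h
  · rw [h]; exact le_top
  rw [← ENNReal.ofReal_toReal h, totalVariation_le_ofReal_iff hΩ ENNReal.toReal_nonneg]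
  have h1 := (totalVariation_le_ofReal_iff hΩ ENNReal.toReal_nonneg).1 (ENNReal.ofReal_toReal h).ge
  have h2 := h1.clip hΩ ((integrable_indicator_iff hΩ.measurableSet).2 hu)
  -- Since `clip 0 = 0`, truncation commutes with extension by zero.
  convert h2 using 1
  ext x
  by_cases hx : x ∈ Ω <;> simp [hx, clip]

theorem totalVariation_le_liminf (hb : Bornology.IsBounded Ω)
    {u : ℕ → EuclideanSpace ℝ (Fin N) → ℝ} {v : EuclideanSpace ℝ (Fin N) → ℝ}
    (hm : ∀ n, AEStronglyMeasurable (u n) (volume.restrict Ω))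
    (h01 : ∀ n, ∀ᵐ x ∂(volume.restrict Ω), u n x ∈ Icc (0 : ℝ) 1)
    (hlim : ∀ᵐ x ∂(volume.restrict Ω), Tendsto (fun n => u n x) atTop (𝓝 (v x))) :
    totalVariation Ω v ≤ liminf (fun n => totalVariation Ω (u n)) atTop := by
  have hfin : IsFiniteMeasure (volume.restrict Ω) := isFiniteMeasure_restrict.2 hb.measure_lt_top.ne
  refine iSup₂_le fun φ hφ => ?_
  obtain ⟨M, hM⟩ := exists_abs_divergence_le hφ.1 hφ.2.1
  have hconv : Tendsto (fun n => ∫ x in Ω, u n x * divergence φ x) atTop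
      (𝓝 (∫ x in Ω, v x * divergence φ x)) := by
    refine tendsto_integral_of_dominated_convergence (fun _ => M)
      (fun n => (hm n).mul (continuous_divergence hφ.1).aestronglyMeasurable)
      (integrable_const M) (fun n => ?_) ?_
    · filter_upwards [h01 n] with x hx
      rw [norm_mul, Real.norm_of_nonneg hx.1]
      exact (mul_le_of_le_one_left (norm_nonneg _) hx.2).trans (hM x)
    · exact hlim.mono fun x hx => hx.mul_const _
  rw [← (ENNReal.tendsto_ofReal hconv).liminf_eq]
  exact liminf_le_liminf (Eventually.of_forall fun n =>
    le_iSup₂ (f := fun φ _ => ENNReal.ofReal (∫ x in Ω, u n x * divergence φ x)) φ hφ)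

theorem measurable_unitIndicator : Measurable unitIndicator :=
  Measurable.ite measurableSet_Icc measurable_const measurable_const

theorem lintegral_unitIndicator_eq_zero {u : EuclideanSpace ℝ (Fin N) → ℝ}
    (h : ∀ᵐ x ∂(volume.restrict Ω), u x ∈ Icc (0 : ℝ) 1) :
    ∫⁻ x in Ω, unitIndicator (u x) = 0 := by
  have h0 : ∀ᵐ x ∂(volume.restrict Ω), unitIndicator (u x) = 0 := h.mono fun x hx => if_pos hx
  rw [lintegral_congr_ae h0, lintegral_zero]

theorem ae_mem_Icc_of_lintegral_unitIndicator_ne_top {u : EuclideanSpace ℝ (Fin N) → ℝ}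
    (hu : AEMeasurable u (volume.restrict Ω)) (h : ∫⁻ x in Ω, unitIndicator (u x) ≠ ∞) :
    ∀ᵐ x ∂(volume.restrict Ω), u x ∈ Icc (0 : ℝ) 1 := by
  filter_upwards [ae_lt_top' (measurable_unitIndicator.comp_aemeasurable hu) h] with x hx
  by_contra hx'
  simp [unitIndicator, hx'] at hx

theorem ennreal_liminf_add_le (a b : ℕ → ℝ≥0∞) :
    liminf a atTop + liminf b atTop ≤ liminf (fun n => a n + b n) atTop := by
  simp only [liminf_eq_iSup_iInf_of_nat]
  rw [ENNReal.iSup_add_iSup_of_monotone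
    (fun m n h => biInf_mono fun i hi => h.trans hi)
    (fun m n h => biInf_mono fun i hi => h.trans hi)]
  exact iSup_mono fun n => le_iInf₂ fun i hi => add_le_add (iInf₂_le i hi) (iInf₂_le i hi)

/-- `clip` is the nearest-point projection onto `[0, 1]`, which contains `t`. -/
theorem sq_clip_sub_le (s : ℝ) {t : ℝ} (ht : t ∈ Icc (0 : ℝ) 1) :
    (clip s - t) ^ 2 ≤ (s - t) ^ 2 := by
  rw [sq_le_sq]
  unfold clip
  have h0 := ht.1
  have h1 := ht.2
  rcases le_total s 0 with h | h
  · rw [min_eq_left (by linarith), max_eq_left h, abs_of_nonpos (by linarith),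
      abs_of_nonpos (by linarith)]
    linarith
  · rcases le_total s 1 with h' | h'
    · rw [min_eq_left h', max_eq_right h]
    · rw [min_eq_right h', max_eq_right zero_le_one, abs_of_nonneg (by linarith),
        abs_of_nonneg (by linarith)]
      linarith

theorem exists_Lp_eq_clip (hb : Bornology.IsBounded Ω) (v : Lp ℝ 2 (volume.restrict Ω)) :
    ∃ w : Lp ℝ 2 (volume.restrict Ω), w =ᵐ[volume.restrict Ω] fun x => clip (v x) := by
  have hfin : IsFiniteMeasure (volume.restrict Ω) := isFiniteMeasure_restrict.2 hb.measure_lt_top.ne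
  have h : MemLp (fun x => clip (v x)) 2 (volume.restrict Ω) := by
    refine MemLp.of_bound
      (continuous_clip.comp_aestronglyMeasurable (Lp.aestronglyMeasurable v)) 1
      (Eventually.of_forall fun x => ?_)
    rw [Real.norm_of_nonneg (clip_mem_Icc _).1]
    exact (clip_mem_Icc _).2
  exact ⟨h.toLp, h.coeFn_toLp⟩

variable {f : EuclideanSpace ℝ (Fin N) → ℝ} {lam ε : ℝ}

/-- The energy with the constraint on the first argument as a summand of its own, outside of the
integral of the fidelity term. -/
noncomputable def constrainedEnergy (Ω : Set (EuclideanSpace ℝ (Fin N)))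
    (f : EuclideanSpace ℝ (Fin N) → ℝ) (lam ε : ℝ)
    (u v₁ v₂ : Lp ℝ 2 (volume.restrict Ω)) : ℝ≥0∞ :=
  totalVariation Ω u
    + ENNReal.ofReal (1 / ε) * (totalVariation Ω v₁ + totalVariation Ω v₂)
    + ENNReal.ofReal lam *
        (∫⁻ x in Ω, ENNReal.ofReal (u x * (v₁ x - f x) ^ 2 + (1 - u x) * (v₂ x - f x) ^ 2))
    + (∫⁻ x in Ω, unitIndicator (u x))

/-- The functionals differ only in where the constraint integral stands, and here it is zero. -/
theorem energy_eq_constrainedEnergy {u : Lp ℝ 2 (volume.restrict Ω)}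
    (hu : ∀ᵐ x ∂(volume.restrict Ω), u x ∈ Icc (0 : ℝ) 1) (v₁ v₂ : Lp ℝ 2 (volume.restrict Ω)) :
    energy Ω f lam ε u v₁ v₂ = constrainedEnergy Ω f lam ε u v₁ v₂ := by
  simp only [energy, constrainedEnergy, lintegral_unitIndicator_eq_zero hu, add_zero]

theorem ae_mem_Icc_of_constrainedEnergy_ne_top {u v₁ v₂ : Lp ℝ 2 (volume.restrict Ω)}
    (h : constrainedEnergy Ω f lam ε u v₁ v₂ ≠ ∞) :
    ∀ᵐ x ∂(volume.restrict Ω), u x ∈ Icc (0 : ℝ) 1 :=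
  ae_mem_Icc_of_lintegral_unitIndicator_ne_top (Lp.aestronglyMeasurable u).aemeasurable
    (ne_top_of_le_ne_top h le_add_self)

/-- The constraint integral is a constant added to the fidelity integrand. Were it infinite,
finiteness of the outer integral would force `Ω` to be null, and the claim would be vacuous. -/
theorem ae_mem_Icc_of_energy_ne_top (hf : AEMeasurable f (volume.restrict Ω)) (hlam : 0 < lam)
    {u v₁ v₂ : Lp ℝ 2 (volume.restrict Ω)} (h : energy Ω f lam ε u v₁ v₂ ≠ ∞) :
    ∀ᵐ x ∂(volume.restrict Ω), u x ∈ Icc (0 : ℝ) 1 := by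
  have a (z : Lp ℝ 2 (volume.restrict Ω)) := (Lp.aestronglyMeasurable z).aemeasurable
  unfold energy at h
  have h1 := ne_top_of_le_ne_top h le_add_self
  have h2 := ENNReal.lt_top_of_mul_ne_top_right h1 (by simpa using hlam)
  have h3 := ae_lt_top' (((((a u).mul (((a v₁).sub hf).pow_const 2)).add
    (((a u).const_sub 1).mul (((a v₂).sub hf).pow_const 2))).ennreal_ofReal).add_const _) h2.ne
  by_cases hI : ∫⁻ x in Ω, unitIndicator (u x) = ∞
  · filter_upwards [h3] with x hx
    rw [hI, add_top] at hx
    exact absurd hx (lt_irrefl _)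
  · exact ae_mem_Icc_of_lintegral_unitIndicator_ne_top (a u) hI

/-- Truncating the second and third argument does not increase the energy. -/
theorem constrainedEnergy_clip_le (hΩ : IsOpen Ω) (hb : Bornology.IsBounded Ω)
    (hf : ∀ᵐ x ∂(volume.restrict Ω), f x ∈ Icc (0 : ℝ) 1)
    {u v₁ v₂ w₁ w₂ : Lp ℝ 2 (volume.restrict Ω)}
    (hu : ∀ᵐ x ∂(volume.restrict Ω), u x ∈ Icc (0 : ℝ) 1)
    (h₁ : w₁ =ᵐ[volume.restrict Ω] fun x => clip (v₁ x))
    (h₂ : w₂ =ᵐ[volume.restrict Ω] fun x => clip (v₂ x)) :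
    constrainedEnergy Ω f lam ε u w₁ w₂ ≤ constrainedEnergy Ω f lam ε u v₁ v₂ := by
  have hfin : IsFiniteMeasure (volume.restrict Ω) := isFiniteMeasure_restrict.2 hb.measure_lt_top.ne
  have hTV {v w : Lp ℝ 2 (volume.restrict Ω)} (h : w =ᵐ[volume.restrict Ω] fun x => clip (v x)) :
      totalVariation Ω w ≤ totalVariation Ω v :=
    (totalVariation_congr_ae h).trans_le
      (totalVariation_clip_le hΩ ((Lp.memLp v).integrable one_le_two))
  unfold constrainedEnergy
  refine add_le_add_left (add_le_add (add_le_add_right (mul_le_mul_right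
    (add_le_add (hTV h₁) (hTV h₂)) _) _) (mul_le_mul_right (lintegral_mono_ae ?_) _)) _
  filter_upwards [hf, hu, h₁, h₂] with x hfx hux h1 h2
  rw [h1, h2]
  refine ENNReal.ofReal_le_ofReal (add_le_add ?_ ?_)
  · exact mul_le_mul_of_nonneg_left (sq_clip_sub_le _ hfx) hux.1
  · exact mul_le_mul_of_nonneg_left (sq_clip_sub_le _ hfx) (by linarith [hux.2])

theorem constrainedEnergy_le_liminf (hb : Bornology.IsBounded Ω)
    (hf : AEMeasurable f (volume.restrict Ω))
    {U V W : ℕ → Lp ℝ 2 (volume.restrict Ω)} {u v w : Lp ℝ 2 (volume.restrict Ω)}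
    (hU : ∀ n, ∀ᵐ x ∂(volume.restrict Ω), U n x ∈ Icc (0 : ℝ) 1)
    (hV : ∀ n, ∀ᵐ x ∂(volume.restrict Ω), V n x ∈ Icc (0 : ℝ) 1)
    (hW : ∀ n, ∀ᵐ x ∂(volume.restrict Ω), W n x ∈ Icc (0 : ℝ) 1)
    (hu : ∀ᵐ x ∂(volume.restrict Ω), u x ∈ Icc (0 : ℝ) 1)
    (hUu : ∀ᵐ x ∂(volume.restrict Ω), Tendsto (fun n => U n x) atTop (𝓝 (u x)))
    (hVv : ∀ᵐ x ∂(volume.restrict Ω), Tendsto (fun n => V n x) atTop (𝓝 (v x)))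
    (hWw : ∀ᵐ x ∂(volume.restrict Ω), Tendsto (fun n => W n x) atTop (𝓝 (w x))) :
    constrainedEnergy Ω f lam ε u v w ≤ liminf
    (fun n => constrainedEnergy Ω f lam ε (U n) (V n) (W n)) atTop := by
  have hm (z : Lp ℝ 2 (volume.restrict Ω)) := Lp.aestronglyMeasurable z
  have tU := totalVariation_le_liminf hb (fun n => hm (U n)) hU hUu
  have tV := totalVariation_le_liminf hb (fun n => hm (V n)) hV hVv
  have tW := totalVariation_le_liminf hb (fun n => hm (W n)) hW hWw
  have tF : ∫⁻ x in Ω, ENNReal.ofReal (u x * (v x - f x) ^ 2 + (1 - u x) * (w x - f x) ^ 2)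
      ≤ liminf (fun n => ∫⁻ x in Ω,
        ENNReal.ofReal (U n x * (V n x - f x) ^ 2 + (1 - U n x) * (W n x - f x) ^ 2)) atTop := by
    refine le_trans (le_of_eq (lintegral_congr_ae ?_)) (lintegral_liminf_le' fun n => ?_)
    · filter_upwards [hUu, hVv, hWw] with x h1 h2 h3
      refine (Tendsto.liminf_eq (ENNReal.tendsto_ofReal ?_)).symm
      exact (h1.mul ((h2.sub_const _).pow 2)).add
        ((tendsto_const_nhds.sub h1).mul ((h3.sub_const _).pow 2))
    · have a1 := (hm (U n)).aemeasurable
      have a2 := (hm (V n)).aemeasurable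
      have a3 := (hm (W n)).aemeasurable
      exact ((a1.mul ((a2.sub hf).pow_const 2)).add
        ((a1.const_sub 1).mul ((a3.sub hf).pow_const 2))).ennreal_ofReal
  unfold constrainedEnergy
  simp only [lintegral_unitIndicator_eq_zero hu, lintegral_unitIndicator_eq_zero (hU _), add_zero]
  refine le_trans (add_le_add (add_le_add tU (mul_le_mul_right (add_le_add tV tW) _))
    (mul_le_mul_right tF _)) ?_
  refine le_trans ?_ (ennreal_liminf_add_le _ _)
  refine add_le_add (le_trans ?_ (ennreal_liminf_add_le _ _)) ?_
  · refine add_le_add_right ?_ _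
    rw [ENNReal.liminf_const_mul_of_ne_top ENNReal.ofReal_ne_top]
    exact mul_le_mul_right (ennreal_liminf_add_le _ _) _
  · rw [ENNReal.liminf_const_mul_of_ne_top ENNReal.ofReal_ne_top]

/-- For the zero triple only the integral of `f ^ 2 ≤ 1` remains. This gives a competitor of finite
energy, and of energy zero when `lam = 0`. -/
theorem constrainedEnergy_zero_le
    (hf : ∀ᵐ x ∂(volume.restrict Ω), f x ∈ Icc (0 : ℝ) 1) :
    constrainedEnergy Ω f lam ε 0 0 0 ≤ ENNReal.ofReal lam * volume Ω := by
  have h0 : ((0 : Lp ℝ 2 (volume.restrict Ω)) : EuclideanSpace ℝ (Fin N) → ℝ)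
      =ᵐ[volume.restrict Ω] fun _ => 0 := Lp.coeFn_zero _ _ _
  have hTV : totalVariation Ω (0 : Lp ℝ 2 (volume.restrict Ω)) = 0 := by
    rw [totalVariation_congr_ae h0]
    simp [totalVariation]
  have h01 : ∀ᵐ x ∂(volume.restrict Ω),
      (0 : Lp ℝ 2 (volume.restrict Ω)) x ∈ Icc (0 : ℝ) 1 := h0.mono fun x hx => by
      rw [hx]
      exact ⟨le_rfl, zero_le_one⟩
  have hF : ∫⁻ x in Ω, ENNReal.ofReal ((0 : Lp ℝ 2 (volume.restrict Ω)) x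
      * ((0 : Lp ℝ 2 (volume.restrict Ω)) x - f x) ^ 2
      + (1 - (0 : Lp ℝ 2 (volume.restrict Ω)) x)
      * ((0 : Lp ℝ 2 (volume.restrict Ω)) x - f x) ^ 2) ≤ volume Ω := by
    rw [← setLIntegral_one]
    refine lintegral_mono_ae ?_
    filter_upwards [h0, hf] with x hx hfx
    rw [hx, ENNReal.ofReal_le_one]
    nlinarith [hfx.1, hfx.2]
  unfold constrainedEnergy
  rw [hTV, lintegral_unitIndicator_eq_zero h01]
  simp only [add_zero, mul_zero, zero_add]
  exact mul_le_mul_right hF _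

/-- The constrained energy has a minimizer of bounded variation. -/
theorem exists_minimizer_constrainedEnergy (hΩ_open : IsOpen Ω) (hΩ_bdd : Bornology.IsBounded Ω)
    (hf_meas : AEMeasurable f (volume.restrict Ω))
    (hf_range : ∀ᵐ x ∂(volume.restrict Ω), f x ∈ Icc (0 : ℝ) 1) (lam : ℝ) (hε : 0 < ε) :
    ∃ u v₁ v₂ : Lp ℝ 2 (volume.restrict Ω), MemBV Ω u ∧ MemBV Ω v₁ ∧ MemBV Ω v₂ ∧
      ∀ u' v₁' v₂' : Lp ℝ 2 (volume.restrict Ω),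
        constrainedEnergy Ω f lam ε u v₁ v₂ ≤ constrainedEnergy Ω f lam ε u' v₁' v₂' := by
  have hfin : IsFiniteMeasure (volume.restrict Ω) :=
    isFiniteMeasure_restrict.2 hΩ_bdd.measure_lt_top.ne
  set F := constrainedEnergy Ω f lam ε with hF
  have hE₀ : F 0 0 0 < ∞ := (constrainedEnergy_zero_le hf_range).trans_lt
    (ENNReal.mul_lt_top ENNReal.ofReal_lt_top hΩ_bdd.measure_lt_top)
  -- Cutting off at the finite value `F 0 0 0` leaves the infimum unchanged and gives every term of
  -- the minimizing sequence the constraint and a variation bound.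
  set S : Set ℝ≥0∞ := {e | e ≤ F 0 0 0 ∧ ∃ u v₁ v₂, F u v₁ v₂ = e}
  have hS₀ : F 0 0 0 ∈ S := ⟨le_rfl, 0, 0, 0, rfl⟩
  obtain ⟨e, -, he, heS⟩ := exists_seq_tendsto_sInf (S := S)
    ⟨F 0 0 0, hS₀⟩ (OrderBot.bddBelow S)
  have hmin (u v₁ v₂ : Lp ℝ 2 (volume.restrict Ω)) : sInf S ≤ F u v₁ v₂ := by
    rcases le_total (F u v₁ v₂) (F 0 0 0) with h | h
    · exact sInf_le (show F u v₁ v₂ ∈ S from ⟨h, u, v₁, v₂, rfl⟩)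
    · exact (sInf_le hS₀).trans h
  have hclip (n : ℕ) : ∃ u v₁ v₂ : Lp ℝ 2 (volume.restrict Ω),
      (∀ᵐ x ∂(volume.restrict Ω), u x ∈ Icc (0 : ℝ) 1) ∧
      (∀ᵐ x ∂(volume.restrict Ω), v₁ x ∈ Icc (0 : ℝ) 1) ∧
      (∀ᵐ x ∂(volume.restrict Ω), v₂ x ∈ Icc (0 : ℝ) 1) ∧ F u v₁ v₂ ≤ e n := by
    obtain ⟨hle, u, v₁, v₂, hn⟩ := heS n
    have hu : ∀ᵐ x ∂(volume.restrict Ω), u x ∈ Icc (0 : ℝ) 1 :=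
      ae_mem_Icc_of_constrainedEnergy_ne_top (ne_top_of_le_ne_top hE₀.ne (hn.trans_le hle))
    obtain ⟨w₁, hw₁⟩ := exists_Lp_eq_clip hΩ_bdd v₁
    obtain ⟨w₂, hw₂⟩ := exists_Lp_eq_clip hΩ_bdd v₂
    exact ⟨u, w₁, w₂, hu, hw₁.mono fun x hx => hx ▸ clip_mem_Icc _,
      hw₂.mono fun x hx => hx ▸ clip_mem_Icc _,
      (constrainedEnergy_clip_le hΩ_open hΩ_bdd hf_range hu hw₁ hw₂).trans hn.le⟩
  choose U V W hU hV hW hUVW using hclip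
  have hbound (u v₁ v₂ : Lp ℝ 2 (volume.restrict Ω)) : totalVariation Ω u ≤ F u v₁ v₂ ∧
      totalVariation Ω v₁ ≤ ENNReal.ofReal ε * F u v₁ v₂ ∧
      totalVariation Ω v₂ ≤ ENNReal.ofReal ε * F u v₁ v₂ := by
    have h1 : ENNReal.ofReal ε * ENNReal.ofReal (1 / ε) = 1 := by
      rw [← ENNReal.ofReal_mul hε.le, mul_one_div_cancel hε.ne', ENNReal.ofReal_one]
    have h2 : totalVariation Ω v₁ + totalVariation Ω v₂
        ≤ ENNReal.ofReal ε * F u v₁ v₂ := by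
      rw [← one_mul (totalVariation Ω v₁ + _), ← h1, mul_assoc]
      refine mul_le_mul_right ?_ _
      exact le_add_self.trans (le_self_add.trans le_self_add)
    exact ⟨le_self_add.trans (le_self_add.trans le_self_add), le_self_add.trans h2,
      le_add_self.trans h2⟩
  obtain ⟨C, hC0, hC⟩ : ∃ C : ℝ, 0 ≤ C ∧
      F 0 0 0 + ENNReal.ofReal ε * F 0 0 0 = ENNReal.ofReal C :=
    ⟨_, ENNReal.toReal_nonneg, (ENNReal.ofReal_toReal (ENNReal.add_lt_top.2
      ⟨hE₀, ENNReal.mul_lt_top ENNReal.ofReal_lt_top hE₀⟩).ne).symm⟩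
  have hFn (n) : F (U n) (V n) (W n) ≤ F 0 0 0 := (hUVW n).trans (heS n).1
  have hUC (n) : VarLe Ω (Ω.indicator (U n)) C := by
    rw [← totalVariation_le_ofReal_iff hΩ_open hC0, ← hC]
    exact ((hbound _ _ _).1.trans (hFn n)).trans le_self_add
  have hVC (n) : VarLe Ω (Ω.indicator (V n)) C := by
    rw [← totalVariation_le_ofReal_iff hΩ_open hC0, ← hC]
    exact ((hbound _ _ _).2.1.trans (mul_le_mul_right (hFn n) _)).trans le_add_self
  have hWC (n) : VarLe Ω (Ω.indicator (W n)) C := by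
    rw [← totalVariation_le_ofReal_iff hΩ_open hC0, ← hC]
    exact ((hbound _ _ _).2.2.trans (mul_le_mul_right (hFn n) _)).trans le_add_self
  -- The three subsequences are nested, so all components converge along the last one.
  obtain ⟨u, σ₁, hσ₁, hu, hUu⟩ := exists_subseq_tendsto_ae hΩ_open hΩ_bdd hU hUC
  obtain ⟨v, σ₂, hσ₂, -, hVv⟩ := exists_subseq_tendsto_ae hΩ_open hΩ_bdd
    (fun n => hV (σ₁ n)) (fun n => hVC (σ₁ n))
  obtain ⟨w, σ₃, hσ₃, -, hWw⟩ := exists_subseq_tendsto_ae hΩ_open hΩ_bdd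
    (fun n => hW (σ₁ (σ₂ n))) (fun n => hWC (σ₁ (σ₂ n)))
  have hle : F u v w ≤ sInf S := by
    refine (constrainedEnergy_le_liminf hΩ_bdd hf_meas (fun n => hU (σ₁ (σ₂ (σ₃ n))))
      (fun n => hV (σ₁ (σ₂ (σ₃ n)))) (fun n => hW (σ₁ (σ₂ (σ₃ n)))) hu
      (hUu.mono fun x hx => hx.comp (hσ₂.comp hσ₃).tendsto_atTop)
      (hVv.mono fun x hx => hx.comp hσ₃.tendsto_atTop) hWw).trans ?_
    rw [← (he.comp (hσ₁.comp (hσ₂.comp hσ₃)).tendsto_atTop).liminf_eq]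
    exact liminf_le_liminf (Eventually.of_forall fun n => hUVW _)
  have htop : F u v w < ∞ := (hle.trans (hmin 0 0 0)).trans_lt hE₀
  have hint (z : Lp ℝ 2 (volume.restrict Ω)) : IntegrableOn z Ω :=
    (Lp.memLp z).integrable one_le_two
  have hb := hbound u v w
  exact ⟨u, v, w, ⟨hint u, hb.1.trans_lt htop⟩,
    ⟨hint v, hb.2.1.trans_lt (ENNReal.mul_lt_top ENNReal.ofReal_lt_top htop)⟩,
    ⟨hint w, hb.2.2.trans_lt (ENNReal.mul_lt_top ENNReal.ofReal_lt_top htop)⟩,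
    fun u' v₁' v₂' => hle.trans (hmin u' v₁' v₂')⟩

end Energy

end ChanVese

theorem mainTheorem5 (N : ℕ) (hN : 1 ≤ N) (Ω : Set (EuclideanSpace ℝ (Fin N)))
    (hΩ_open : IsOpen Ω) (hΩ_bdd : Bornology.IsBounded Ω)
    (hΩ_lip : ChanVese.HasLipschitzBoundary Ω)
    (f : EuclideanSpace ℝ (Fin N) → ℝ)
    (hf_meas : AEMeasurable f (volume.restrict Ω))
    (hf_range : ∀ᵐ x ∂(volume.restrict Ω), f x ∈ Icc (0 : ℝ) 1)
    (lam : ℝ) (hlam : 0 ≤ lam) (ε : ℝ) (hε : 0 < ε) :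
    ∃ u v₁ v₂ : Lp ℝ 2 (volume.restrict Ω),
      ChanVese.MemBV Ω u ∧ ChanVese.MemBV Ω v₁ ∧ ChanVese.MemBV Ω v₂ ∧
        ∀ u' v₁' v₂' : Lp ℝ 2 (volume.restrict Ω),
          ChanVese.energy Ω f lam ε u v₁ v₂ ≤ ChanVese.energy Ω f lam ε u' v₁' v₂' := by
  have hfin : IsFiniteMeasure (volume.restrict Ω) :=
    isFiniteMeasure_restrict.2 hΩ_bdd.measure_lt_top.ne
  obtain ⟨u, v₁, v₂, hu, hv₁, hv₂, hmin⟩ := ChanVese.exists_minimizer_constrainedEnergy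
    hΩ_open hΩ_bdd hf_meas hf_range lam hε
  have h0 := ChanVese.constrainedEnergy_zero_le (lam := lam) (ε := ε) hf_range
  have hu01 := ChanVese.ae_mem_Icc_of_constrainedEnergy_ne_top
    (((hmin 0 0 0).trans h0).trans_lt
      (ENNReal.mul_lt_top ENNReal.ofReal_lt_top hΩ_bdd.measure_lt_top)).ne
  refine ⟨u, v₁, v₂, hu, hv₁, hv₂, fun u' v₁' v₂' => ?_⟩
  rw [ChanVese.energy_eq_constrainedEnergy hu01]
  -- For `lam = 0` the factor 0 cancels even an infinite constraint integral, so competitors need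
  -- not satisfy `0 ≤ u' ≤ 1`; but the minimizer then has energy 0. For `lam > 0` competitors of
  -- finite energy satisfy the constraint and the functionals agree.
  rcases hlam.eq_or_lt with rfl | hlam
  · refine ((hmin 0 0 0).trans h0).trans ?_
    simp
  · by_cases htop : ChanVese.energy Ω f lam ε u' v₁' v₂' = ∞
    · rw [htop]
      exact le_top
    · rw [ChanVese.energy_eq_constrainedEnergy
        (ChanVese.ae_mem_Icc_of_energy_ne_top hf_meas hlam htop)]
      exact hmin u' v₁' v₂'
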